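/- Let $G$ be a wreath-like product of groups $A$ and $B$ with respect to an action $B\curvearrowright I$: there is an exact sequence $1\to A^{(I)}\to G\xrightarrow{\varepsilon}B\to1$, where $A^{(I)}=\bigoplus_{i\in I}A_i$ with $A_i\cong A$, such that $gA_ig^{-1}=A_{\varepsilon(g)i}$ for all $g\in G$, $i\in I$. Assume that $G$ has bounded cocycle: there are a set-theoretic section $\varsigma\colon B\to G$ of $\varepsilon$ and a constant $C$ such that $|\mathrm{supp}(\varsigma(x)\varsigma(y)\varsigma(xy)^{-1})|\le C$ for all $x,y\in B$. Put $\varsigma'(1)=1$ and $\varsigma'(b)=\varsigma(b)$ for $b\neq1$; every $g\in G$ is uniquely of the form $g=c\,\varsigma'(b)$ with $c\in A^{(I)}$, $b\in B$, and the support array $\mathfrak q\colon G\to\ell^2(I)$ is defined by letting $\mathfrak q(g)$ be the indicator function of $\mathrm{supp}(c)\subseteq I$. Let $(\mathcal N,\tau)$ be a von Neumann algebra with a faithful normal tracial state, and let $\mathcal M=\mathcal N\bar\otimes\mathcal L(A^{(I)})$, so that $L^2(\mathcal M)=L^2(\mathcal N)\otimes\ell^2(A^{(I)})$. Gaussian deformation: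 let $(Y,\nu)$ be the Gaussian probability space of the real Hilbert space $\ell^2(I)$, with unitaries $\omega(v)\in L^\infty(Y,\nu)$, $v\in\ell^2(I)$, such that $\omega(v+w)=\omega(v)\omega(w)$, $\omega(v)^*=\omega(-v)$ and $\int\omega(v)\,d\nu=e^{-\|v\|^2}$; explicitly $\omega(v)=\exp(i\sqrt2\,X(v))$ for the isonormal Gaussian process $X$. For $s\in\mathbb R$ let $V^{\mathfrak q}_s$ be the unitary of $L^2(Y,\nu)\otimes L^2(\mathcal N)\otimes\ell^2(G)$ with $V^{\mathfrak q}_s(\zeta\otimes x\otimes\delta_h)=\omega(s\,\mathfrak q(h))\zeta\otimes x\otimes\delta_h$. Here $L^2(\mathcal M)$ is identified with $1\otimes L^2(\mathcal N)\otimes\ell^2(A^{(I)})$. Ioana's deformation: let $\tilde A=A*\mathbb Z$, let $u\in\mathcal L(\mathbb Z)$ be the canonical generating Haar unitary, let $h=h^*\in\mathcal L(\mathbb Z)$ have spectrum $[-\pi,\pi]$ with $e^{ih}=u$, and put $u^t=e^{ith}$. Let $\alpha_t$ be the trace-preserving automorphism $\mathrm{id}\otimes\bigotimes_{i\in I}\mathrm{Ad}(u^t)$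 of $\mathcal N\bar\otimes\mathcal L(\tilde A^{(I)})\supseteq\mathcal M$, extended to $L^2(\mathcal N)\otimes\ell^2(\tilde A^{(I)})$. In both cases let $e_{\mathcal M}^\perp$ be the orthogonal projection onto the orthogonal complement of $L^2(\mathcal M)$ in the larger Hilbert space. Then for every $\xi\in L^2(\mathcal M)$ and every $0\le t<1/\pi$, $$\Bigl\|e_{\mathcal M}^\perp V^{\mathfrak q}_{\sqrt{\frac{\pi^2+5}{3(\pi^2-1)}}\,\pi t}(\xi)\Bigr\|_2\;\ge\;\bigl\|e_{\mathcal M}^\perp\alpha_t(\xi)\bigr\|_2\;\ge\;\Bigl\|e_{\mathcal M}^\perp V^{\mathfrak q}_{\sqrt{\frac13}\,\pi t}(\xi)\Bigr\|_2,$$ and also $$\bigl\|e_{\mathcal M}^\perp\alpha_t(\xi)\bigr\|_2\;\ge\;\Bigl\|e_{\mathcal M}^\perp V^{\mathfrak q}_{\sqrt{\frac16}\,\pi t}(\xi)\Bigr\|_2 .$$ -/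

import Mathlib

open MeasureTheory Function
open scoped ENNReal ComplexOrder

set_option linter.unusedSectionVars false

noncomputable section

namespace WreathDeformation

/-! ## Square-summable families -/

/-- `L2 Γ K` is the Hilbert space `K ⊗ ℓ²(Γ)`, realised as the space of square-summable
families `ξ = (ξ_g)` of vectors of `K`; the elementary tensor `x ⊗ δ_g` is `lp.single 2 g x`. -/
abbrev L2 (Γ K : Type*) [NormedAddCommGroup K] : Type _ := lp (fun _ : Γ => K) 2

section HilbertSpace

variable {Γ Δ K K' : Type*}
  [NormedAddCommGroup K] [InnerProductSpace ℂ K] [CompleteSpace K]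
  [NormedAddCommGroup K'] [InnerProductSpace ℂ K'] [CompleteSpace K']

open Classical in
/-- `x ↦ x ⊗ δ_g` as an isometry. -/
def single (g : Γ) : K →ₗᵢ[ℂ] L2 Γ K where
  toLinearMap := (lp.lsingle (𝕜 := ℂ) (E := fun _ : Γ => K) 2 g)
  norm_map' x := lp.norm_single (E := fun _ : Γ => K) (by norm_num) g x

open Classical in
theorem single_apply (g : Γ) (x : K) (k : Γ) : single g x k = if k = g then x else 0 := by
  have h : single g x = lp.single (E := fun _ : Γ => K) 2 g x := rfl
  rw [h, lp.single_apply]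
  by_cases hk : k = g
  · subst hk; simp
  · simp [hk]

open Classical in
theorem inner_single_left (g : Γ) (x : K) (f : L2 Γ K) :
    inner ℂ (single g x) f = inner ℂ x (f g) :=
  lp.inner_single_left (𝕜 := ℂ) (G := fun _ : Γ => K) g x f

open Classical in
theorem hasSum_single (f : L2 Γ K) : HasSum (fun g => single g (f g)) f :=
  lp.hasSum_single (E := fun _ : Γ => K) (by norm_num) f

theorem clm_ext {T S : L2 Γ K →L[ℂ] L2 Δ K'} (h : ∀ g x, T (single g x) = S (single g x)) :
    T = S := by
  ext1 f
  have h1 := (hasSum_single f).mapL T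
  have h2 := (hasSum_single f).mapL S
  simp only [h] at h1
  exact h1.unique h2

theorem lim_ext {T S : L2 Γ K →ₗᵢ[ℂ] L2 Δ K'} (h : ∀ g x, T (single g x) = S (single g x)) :
    T = S := by
  have := clm_ext (T := T.toContinuousLinearMap) (S := S.toContinuousLinearMap) h
  ext1 f
  exact congrArg (fun R : L2 Γ K →L[ℂ] L2 Δ K' => R f) this

/-- Evaluation at a point, as a continuous linear map. -/
def evalL (k : Γ) : L2 Γ K →L[ℂ] K :=
  LinearMap.mkContinuous
    { toFun := fun f => f k, map_add' := fun _ _ => rfl, map_smul' := fun _ _ => rfl } 1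
    (fun f => by
      rw [one_mul]
      exact lp.norm_apply_le_norm (E := fun _ : Γ => K) (by norm_num) f k)

@[simp] theorem evalL_apply (k : Γ) (f : L2 Γ K) : evalL k f = f k := rfl

theorem orthogonalFamily_l2map (f : Γ → Δ) (hf : Injective f) (j : Γ → K →ₗᵢ[ℂ] K') :
    OrthogonalFamily ℂ (fun _ : Γ => K) (fun g => (single (f g)).comp (j g)) := by
  intro g g' hgg' x y
  have hne : f g ≠ f g' := fun h => hgg' (hf h)
  change inner ℂ (single (f g) (j g x)) (single (f g') (j g' y)) = 0
  rw [inner_single_left, single_apply, if_neg hne, inner_zero_right]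

/-- The isometry `K ⊗ ℓ²(Γ) → K' ⊗ ℓ²(Δ)` with `x ⊗ δ_g ↦ j_g(x) ⊗ δ_{f(g)}`, for an injective map
`f` and isometries `j_g`. -/
def l2map (f : Γ → Δ) (hf : Injective f) (j : Γ → K →ₗᵢ[ℂ] K') : L2 Γ K →ₗᵢ[ℂ] L2 Δ K' :=
  (orthogonalFamily_l2map f hf j).linearIsometry

open Classical in
theorem l2map_single (f : Γ → Δ) (hf : Injective f) (j : Γ → K →ₗᵢ[ℂ] K') (g : Γ) (x : K) :
    l2map f hf j (single g x) = single (f g) (j g x) :=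
  (orthogonalFamily_l2map f hf j).linearIsometry_apply_single x

theorem l2map_hasSum (f : Γ → Δ) (hf : Injective f) (j : Γ → K →ₗᵢ[ℂ] K') (ξ : L2 Γ K) :
    HasSum (fun g => single (f g) (j g (ξ g))) (l2map f hf j ξ) :=
  (orthogonalFamily_l2map f hf j).hasSum_linearIsometry ξ

theorem l2map_apply (f : Γ → Δ) (hf : Injective f) (j : Γ → K →ₗᵢ[ℂ] K') (ξ : L2 Γ K) (g : Γ) :
    l2map f hf j ξ (f g) = j g (ξ g) := by
  have h1 := (l2map_hasSum f hf j ξ).mapL (evalL (f g))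
  refine h1.unique ?_
  classical
  convert _root_.hasSum_single g ?_ using 1
  · simp [single_apply]
  · intro g' hg'
    have : f g ≠ f g' := fun h => hg' (hf h).symm
    simp [single_apply, this]

theorem l2map_apply_of_forall_ne (f : Γ → Δ) (hf : Injective f) (j : Γ → K →ₗᵢ[ℂ] K')
    (ξ : L2 Γ K) (k : Δ) (hk : ∀ g, f g ≠ k) : l2map f hf j ξ k = 0 := by
  classical
  have h1 := (l2map_hasSum f hf j ξ).mapL (evalL k)
  refine h1.unique ?_
  convert (hasSum_zero : HasSum (fun _ : Γ => (0 : K')) 0) using 2 with g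
  simp [single_apply, (hk g).symm]

/-- The orthogonal projection onto the complement of the range of the isometry `ι`. -/
def perpProj (ι : K →ₗᵢ[ℂ] K') : K' →L[ℂ] K' := (LinearMap.range ι.toLinearMap)ᗮ.starProjection

end HilbertSpace

/-! ## Fourier coefficients of `θ ↦ exp(itθ)` on `[-π, π]` -/

section Fourier
open Real

/-- The `n`-th Fourier coefficient of `θ ↦ exp(itθ)`, `θ ∈ [-π, π]`. -/
def powCoeff (t : ℝ) (n : ℤ) : ℂ :=
  (2 * π : ℂ)⁻¹ * ∫ θ in (-π)..π, Complex.exp (Complex.I * t * θ) * Complex.exp (-(Complex.I * n * θ))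

theorem powCoeff_add_int (t : ℝ) (k n : ℤ) : powCoeff (t + k) n = powCoeff t (n - k) := by
  unfold powCoeff
  congr 2
  ext θ
  rw [← Complex.exp_add, ← Complex.exp_add]
  congr 1
  push_cast
  ring

theorem powCoeff_neg (t : ℝ) (n : ℤ) : powCoeff (-t) n = (starRingEnd ℂ) (powCoeff t (-n)) := by
  unfold powCoeff
  rw [map_mul, ← intervalIntegral.intervalIntegral_conj]
  congr 1
  · rw [map_inv₀, map_mul, Complex.conj_ofReal, Complex.conj_ofNat]
  · congr 1
    ext θ
    rw [map_mul, ← Complex.exp_conj, ← Complex.exp_conj]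
    simp

theorem powCoeff_int (k : ℤ) : powCoeff k 0 = if k = 0 then 1 else 0 := by
  unfold powCoeff
  split_ifs with h
  · subst h
    have : (2 * π : ℂ) ≠ 0 := by simp [Real.pi_ne_zero]
    simp
    field_simp
    ring
  · have hk : Complex.I * (k : ℂ) ≠ 0 := by simp [h]
    have h1 : ∀ θ : ℝ, Complex.exp (Complex.I * ((k : ℝ) : ℂ) * θ) *
        Complex.exp (-(Complex.I * ((0 : ℤ) : ℂ) * θ)) = Complex.exp (Complex.I * (k : ℂ) * θ) := by
      intro θ; simp
    simp_rw [h1]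
    rw [integral_exp_mul_complex hk]
    have : Complex.exp (Complex.I * k * π) = Complex.exp (Complex.I * k * ((-π : ℝ) : ℂ)) := by
      rw [Complex.exp_eq_exp_iff_exists_int]
      exact ⟨k, by push_cast; ring⟩
    rw [this]
    simp

theorem hasSum_powCoeff' (s s' : ℝ) :
    HasSum (fun n => (starRingEnd ℂ) (powCoeff s n) * powCoeff s' n) (powCoeff (s' - s) 0) := by
  have hab : -π < π := by linarith [Real.pi_pos]
  have hT : Fact (0 < π - -π) := Fact.mk (by linarith)
  have key : ∀ r : ℝ, MemLp (AddCircle.liftIoc (π - -π) (-π)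
      (fun θ : ℝ => Complex.exp (Complex.I * r * θ))) 2 AddCircle.haarAddCircle := by
    intro r
    refine MemLp.haarAddCircle (MemLp.memLp_liftIoc ?_)
    refine MemLp.of_bound (by fun_prop) 1 (ae_of_all _ fun θ => ?_)
    rw [Complex.norm_exp]
    simp
  obtain ⟨E, hE⟩ : ∃ E : ℝ → Lp ℂ 2 (AddCircle.haarAddCircle (T := π - -π)), ∀ r : ℝ,
      E r =ᵐ[AddCircle.haarAddCircle] AddCircle.liftIoc (π - -π) (-π)
        (fun θ : ℝ => Complex.exp (Complex.I * r * θ)) :=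
    ⟨fun r => (key r).toLp _, fun r => (key r).coeFn_toLp⟩
  have hc : ∀ (r : ℝ) (n : ℤ), inner ℂ (fourierBasis (T := π - -π) n) (E r) = powCoeff r n := by
    intro r n
    rw [← HilbertBasis.repr_apply_apply, fourierBasis_repr, fourierCoeff_congr_ae (hE r)]
    change fourierCoeffOn hab _ n = _
    rw [fourierCoeffOn_eq_integral, powCoeff, Complex.real_smul]
    congr 1
    · push_cast; ring
    · congr 1
      ext θ
      rw [fourier_coe_apply, smul_eq_mul, mul_comm]
      congr 2
      have : (π : ℂ) ≠ 0 := by simp [Real.pi_ne_zero]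
      push_cast
      field_simp
      ring
  have h := (fourierBasis (T := π - -π)).hasSum_inner_mul_inner (E s) (E s')
  have e1 : (fun n => (starRingEnd ℂ) (powCoeff s n) * powCoeff s' n) = fun i =>
      inner ℂ (E s) (fourierBasis (T := π - -π) i) *
        inner ℂ (fourierBasis (T := π - -π) i) (E s') := by
    funext n
    rw [← hc s n, ← hc s' n, inner_conj_symm]
  have e2 : powCoeff (s' - s) 0 = inner ℂ (E s) (E s') := by
    rw [L2.inner_def, powCoeff]
    have : (fun x => inner ℂ (E s x) (E s' x)) =ᵐ[AddCircle.haarAddCircle]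
        AddCircle.liftIoc (π - -π) (-π)
          (fun θ : ℝ => Complex.exp (Complex.I * (s' - s : ℝ) * θ)) := by
      filter_upwards [hE s, hE s'] with x h1 h2
      rw [h1, h2]
      simp only [AddCircle.liftIoc, Function.comp, Set.domRestrict_def]
      rw [RCLike.inner_apply', ← Complex.exp_conj, ← Complex.exp_add]
      congr 1
      simp
      ring
    rw [integral_congr_ae this, AddCircle.integral_haarAddCircle,
      AddCircle.integral_liftIoc_eq_intervalIntegral]
    rw [Complex.real_smul]
    congr 1
    · push_cast; ring
    · rw [add_sub_cancel]
      simp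
  rw [e1, e2]
  exact h

theorem hasSum_powCoeff (t : ℝ) (k : ℤ) :
    HasSum (fun n => (starRingEnd ℂ) (powCoeff t n) * powCoeff t (n - k))
      (if k = 0 then 1 else 0) := by
  have h := hasSum_powCoeff' t (t + k)
  simp_rw [powCoeff_add_int] at h
  rwa [show t + (k : ℝ) - t = (k : ℝ) by ring, powCoeff_int] at h

end Fourier

/-! ## Complex powers of the unitary implemented by a permutation -/

section Powers

variable {Γ K : Type*} [NormedAddCommGroup K] [InnerProductSpace ℂ K] [CompleteSpace K]

theorem powCoeff_smul_norm (t : ℝ) (x : K) :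
    HasSum (fun n : ℤ => ‖powCoeff t n • x‖ ^ (2 : ℝ≥0∞).toReal) (‖x‖ ^ (2 : ℝ≥0∞).toReal) := by
  have h := hasSum_powCoeff t 0
  simp only [sub_zero, if_true] at h
  have h2 : HasSum (fun n : ℤ => ‖powCoeff t n‖ ^ 2) 1 := by
    have h3 := Complex.hasSum_re h
    simp only [Complex.conj_mul', Complex.one_re] at h3
    refine h3.congr_fun ?_ |> id
    intro n
    norm_cast
  have h4 := h2.mul_right (‖x‖ ^ 2)
  simpa [norm_smul, mul_pow] using h4

/-- The isometry `x ↦ ∑ₙ c_n(t) x ⊗ δ_n`, where `c_n(t)` are the Fourier coefficients of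
`exp(itθ)`. -/
def powVec (t : ℝ) : K →ₗᵢ[ℂ] L2 ℤ K where
  toFun x := ⟨fun n => powCoeff t n • x,
    memℓp_gen (powCoeff_smul_norm t x).summable⟩
  map_add' x y := by
    ext n
    exact smul_add _ _ _
  map_smul' c x := by
    ext n
    exact smul_comm _ _ _
  norm_map' x := by
    have h : 0 < (2 : ℝ≥0∞).toReal := by norm_num
    refine Real.rpow_left_injOn h.ne' (norm_nonneg _) (norm_nonneg _) ?_
    exact (lp.hasSum_norm h _).unique (powCoeff_smul_norm t x)

theorem powVec_apply (t : ℝ) (x : K) (n : ℤ) : powVec t x n = powCoeff t n • x := rfl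

/-- All orbits of the permutation `σ` are infinite. -/
def FreeOrbits (σ : Equiv.Perm Γ) : Prop := ∀ g, Injective fun n : ℤ => (σ ^ n) g

/-- `x ↦ ∑ₙ c_n(t) x ⊗ δ_{σⁿ(g)}`. -/
def powSingle (σ : Equiv.Perm Γ) (hσ : FreeOrbits σ) (t : ℝ) (g : Γ) : K →ₗᵢ[ℂ] L2 Γ K :=
  (l2map (fun n : ℤ => (σ ^ n) g) (hσ g) fun _ => LinearIsometry.id).comp (powVec t)

theorem powSingle_apply (σ : Equiv.Perm Γ) (hσ : FreeOrbits σ) (t : ℝ) (g : Γ) (x : K) (n : ℤ) :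
    powSingle σ hσ t g x ((σ ^ n) g) = powCoeff t n • x :=
  l2map_apply (fun n : ℤ => (σ ^ n) g) (hσ g) (fun _ => LinearIsometry.id) (powVec t x) n

theorem powSingle_apply_of_forall_ne (σ : Equiv.Perm Γ) (hσ : FreeOrbits σ) (t : ℝ) (g : Γ) (x : K)
    (k : Γ) (hk : ∀ n : ℤ, (σ ^ n) g ≠ k) : powSingle σ hσ t g x k = 0 :=
  l2map_apply_of_forall_ne _ (hσ g) _ (powVec t x) k hk

theorem orthogonalFamily_powSingle (σ : Equiv.Perm Γ) (hσ : FreeOrbits σ) (t : ℝ) :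
    OrthogonalFamily ℂ (fun _ : Γ => K) (powSingle σ hσ t) := by
  intro g g' hne x y
  rw [lp.inner_eq_tsum]
  by_cases h : ∃ k : ℤ, (σ ^ k) g = g'
  · obtain ⟨k, rfl⟩ := h
    have hk : k ≠ 0 := by rintro rfl; simp at hne
    have hs : ∀ b, b ∉ Set.range (fun n : ℤ => (σ ^ n) g) →
        inner ℂ (powSingle σ hσ t g x b) (powSingle σ hσ t ((σ ^ k) g) y b) = 0 := by
      intro b hb
      rw [powSingle_apply_of_forall_ne σ hσ t g x b (fun n hn => hb ⟨n, hn⟩), inner_zero_left]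
    rw [← (hσ g).tsum_eq (f := fun b =>
      inner ℂ (powSingle σ hσ t g x b) (powSingle σ hσ t ((σ ^ k) g) y b))
      (fun b hb => by_contra fun hb' => hb (hs b hb'))]
    have h1 : ∀ n : ℤ, inner ℂ (powSingle σ hσ t g x ((σ ^ n) g))
        (powSingle σ hσ t ((σ ^ k) g) y ((σ ^ n) g)) =
        ((starRingEnd ℂ) (powCoeff t n) * powCoeff t (n - k)) * inner ℂ x y := by
      intro n
      have h2 : (σ ^ n) g = (σ ^ (n - k)) ((σ ^ k) g) := by
        rw [← Equiv.Perm.mul_apply, ← zpow_add, sub_add_cancel]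
      rw [powSingle_apply]
      conv_lhs => rw [h2]
      rw [powSingle_apply, inner_smul_left, inner_smul_right]
      ring
    simp_rw [h1]
    have h3 := (hasSum_powCoeff t k).mul_right (inner ℂ x y)
    rw [if_neg hk, zero_mul] at h3
    exact h3.tsum_eq
  · have : ∀ b, inner ℂ (powSingle σ hσ t g x b) (powSingle σ hσ t g' y b) = 0 := by
      intro b
      by_cases hb : ∃ n : ℤ, (σ ^ n) g = b
      · rw [powSingle_apply_of_forall_ne σ hσ t g' y b, inner_zero_right]
        intro m hm
        obtain ⟨n, hn⟩ := hb
        refine h ⟨n - m, ?_⟩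
        rw [sub_eq_neg_add, zpow_add, Equiv.Perm.mul_apply, hn, ← hm, ← Equiv.Perm.mul_apply,
          ← zpow_add]
        simp
      · push Not at hb
        rw [powSingle_apply_of_forall_ne σ hσ t g x b hb, inner_zero_left]
    simp [this]

/-- Let `U` be the unitary `x ⊗ δ_g ↦ x ⊗ δ_{σ(g)}`, for a permutation `σ` with infinite orbits.
This is `U^t := exp(ith)`, where `h` is the self-adjoint operator with spectrum `[-π, π]`
such that `U = exp(ih)`; that is, `U^t = ∑ₙ c_n(t) Uⁿ` with `∑ₙ c_n(t) exp(inθ)` the Fourier series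
of `exp(itθ)` on `[-π, π]`. -/
def unitaryPow (σ : Equiv.Perm Γ) (hσ : FreeOrbits σ) (t : ℝ) : L2 Γ K →ₗᵢ[ℂ] L2 Γ K :=
  (orthogonalFamily_powSingle σ hσ t).linearIsometry

theorem unitaryPow_single (σ : Equiv.Perm Γ) (hσ : FreeOrbits σ) (t : ℝ) (g : Γ) (x : K) :
    unitaryPow σ hσ t (single g x) = powSingle σ hσ t g x := by
  classical
  exact (orthogonalFamily_powSingle σ hσ t).linearIsometry_apply_single x

theorem hasSum_unitaryPow_apply (σ : Equiv.Perm Γ) (hσ : FreeOrbits σ) (t : ℝ) (ξ : L2 Γ K)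
    (k : Γ) : HasSum (fun n : ℤ => powCoeff t n • ξ ((σ ^ (-n)) k)) (unitaryPow σ hσ t ξ k) := by
  have h := ((orthogonalFamily_powSingle σ hσ t).hasSum_linearIsometry ξ).mapL (evalL k)
  have hinj : Injective fun n : ℤ => (σ ^ (-n)) k := fun m n hmn => by
    have := hσ k hmn
    omega
  have h0 : ∀ g, g ∉ Set.range (fun n : ℤ => (σ ^ (-n)) k) →
      evalL k (powSingle σ hσ t g (ξ g)) = 0 := by
    intro g hg
    refine powSingle_apply_of_forall_ne σ hσ t g _ k fun n hn => hg ⟨n, ?_⟩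
    simp [← hn]
  have h2 := (hinj.hasSum_iff h0).2 h
  have h4 : (fun n : ℤ => powCoeff t n • ξ ((σ ^ (-n)) k)) =
      (fun g => evalL k (powSingle σ hσ t g (ξ g))) ∘ fun n : ℤ => (σ ^ (-n)) k := by
    funext n
    have h3 := powSingle_apply σ hσ t ((σ ^ (-n)) k) (ξ ((σ ^ (-n)) k)) n
    rw [← Equiv.Perm.mul_apply, ← zpow_add, add_neg_cancel, zpow_zero, Equiv.Perm.one_apply] at h3
    exact h3.symm
  rw [h4]
  exact h2

theorem unitaryPow_commute_l2map (σ : Equiv.Perm Γ) (hσ : FreeOrbits σ) (t : ℝ)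
    (ρ : Equiv.Perm Γ) (h : Commute σ ρ) (ξ : L2 Γ K) (k : Γ) :
    unitaryPow σ hσ t ξ (ρ k) = unitaryPow σ hσ t
      (l2map (⇑ρ⁻¹) (ρ⁻¹).injective (fun _ => LinearIsometry.id) ξ) k := by
  refine (hasSum_unitaryPow_apply σ hσ t ξ (ρ k)).unique ?_
  convert hasSum_unitaryPow_apply σ hσ t
    (l2map (⇑ρ⁻¹) (ρ⁻¹).injective (fun _ => LinearIsometry.id) ξ) k using 2 with n
  have h1 : (σ ^ (-n)) k = ρ⁻¹ ((σ ^ (-n)) (ρ k)) := by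
    have h2 : (σ ^ (-n)) (ρ k) = ρ ((σ ^ (-n)) k) := by
      rw [← Equiv.Perm.mul_apply, ← Equiv.Perm.mul_apply, (h.zpow_left (-n)).eq]
    rw [h2]; simp
  rw [h1, l2map_apply]
  rfl

theorem powSingle_hasSum (σ : Equiv.Perm Γ) (hσ : FreeOrbits σ) (t : ℝ) (g : Γ) (x : K) :
    HasSum (fun n : ℤ => single ((σ ^ n) g) (powCoeff t n • x)) (powSingle σ hσ t g x) :=
  l2map_hasSum (K := K) (K' := K) (fun n : ℤ => (σ ^ n) g) (hσ g) (fun _ => LinearIsometry.id)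
    (powVec t x)

/-- Complex powers of commuting permutation unitaries commute. -/
theorem unitaryPow_commute (σ ρ : Equiv.Perm Γ) (hσ : FreeOrbits σ) (hρ : FreeOrbits ρ) (t s : ℝ)
    (h : Commute σ ρ) :
    Commute (unitaryPow (K := K) σ hσ t) (unitaryPow (K := K) ρ hρ s) := by
  refine lim_ext fun g x => ?_
  change unitaryPow σ hσ t (unitaryPow ρ hρ s (single g x)) =
    unitaryPow ρ hρ s (unitaryPow σ hσ t (single g x))
  rw [unitaryPow_single ρ]
  ext k
  have h1 := ((powSingle_hasSum ρ hρ s g x).mapL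
    (unitaryPow (K := K) σ hσ t).toContinuousLinearMap).mapL (evalL k)
  have h2 := hasSum_unitaryPow_apply ρ hρ s (unitaryPow σ hσ t (single g x)) k
  refine h1.unique ?_
  convert h2 using 2 with n
  change unitaryPow σ hσ t (single ((ρ ^ n) g) (powCoeff s n • x)) k = _
  rw [unitaryPow_commute_l2map σ hσ t (ρ ^ (-n)) (h.zpow_right _), map_smul, map_smul]
  have h3 : l2map (⇑(ρ ^ (-n))⁻¹) ((ρ ^ (-n))⁻¹).injective (fun _ => LinearIsometry.id)
      (single g x) = single ((ρ ^ n) g) x := by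
    rw [l2map_single]
    simp
  rw [h3]
  rfl

theorem unitaryPow_neg_cancel (σ : Equiv.Perm Γ) (hσ : FreeOrbits σ) (t : ℝ) (g : Γ) (x : K) :
    unitaryPow σ hσ t (powSingle σ hσ (-t) g x) = single g x := by
  ext k
  have h := hasSum_unitaryPow_apply σ hσ t (powSingle σ hσ (-t) g x) k
  refine h.unique ?_
  by_cases hk : ∃ m : ℤ, (σ ^ m) g = k
  · obtain ⟨m, rfl⟩ := hk
    have h1 : ∀ n : ℤ, powCoeff t n • powSingle σ hσ (-t) g x ((σ ^ (-n)) ((σ ^ m) g)) =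
        ((starRingEnd ℂ) ((starRingEnd ℂ) (powCoeff t n) * powCoeff t (n - m))) • x := by
      intro n
      rw [← Equiv.Perm.mul_apply, ← zpow_add, powSingle_apply, powCoeff_neg, smul_smul, map_mul,
        Complex.conj_conj, neg_add, neg_neg, sub_eq_add_neg]
    simp_rw [h1]
    have h2 := (Complex.hasSum_conj'.2 (hasSum_powCoeff t m)).smul_const x
    have h3 : single g x ((σ ^ m) g) = (starRingEnd ℂ) (if m = 0 then 1 else 0) • x := by
      classical
      rw [single_apply]
      by_cases hm : m = 0
      · subst hm; simp
      · have : (σ ^ m) g ≠ g := fun h => hm (hσ g (by simpa using h))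
        simp [hm, this]
    rw [h3]
    exact h2
  · push Not at hk
    have h1 : ∀ n : ℤ, powCoeff t n • powSingle σ hσ (-t) g x ((σ ^ (-n)) k) = 0 := by
      intro n
      rw [powSingle_apply_of_forall_ne, smul_zero]
      intro m hm
      refine hk (n + m) ?_
      rw [zpow_add, Equiv.Perm.mul_apply, hm]
      simp
    simp_rw [h1]
    have h3 : single g x k = 0 := by
      classical
      rw [single_apply, if_neg]
      rintro rfl
      exact hk 0 (by simp)
    rw [h3]
    exact hasSum_zero

end Powers

/-! ## Conjugation by `u^t` on `K ⊗ ℓ²(Γ)` -/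

section Conjugation

variable {Γ K : Type*} [Group Γ] [NormedAddCommGroup K] [InnerProductSpace ℂ K] [CompleteSpace K]

theorem freeOrbits_mulLeft {a : Γ} (ha : Injective fun n : ℤ => a ^ n) :
    FreeOrbits (Equiv.mulLeft a) := by
  intro g m n h
  simp only [Equiv.zpow_mulLeft, Equiv.coe_mulLeft] at h
  exact ha (mul_right_cancel h)

theorem freeOrbits_mulRight {a : Γ} (ha : Injective fun n : ℤ => a ^ n) :
    FreeOrbits (Equiv.mulRight a) := by
  intro g m n h
  simp only [Equiv.zpow_mulRight, Equiv.coe_mulRight] at h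
  exact ha (mul_left_cancel h)

/-- For an element `a` of infinite order, with group unitary `u = u_a = exp(ih)` and
`u^t = exp(ith)`, the unitary `ξ ↦ u^t ξ (u^t)*` of `K ⊗ ℓ²(Γ) = K ⊗ L²(L(Γ))`: the complex power
of the left translation by `a` composed with the complex power of the right translation. -/
def conjPow (a : Γ) (ha : Injective fun n : ℤ => a ^ n) (t : ℝ) : L2 Γ K →ₗᵢ[ℂ] L2 Γ K :=
  unitaryPow (Equiv.mulLeft a) (freeOrbits_mulLeft ha) t *
    unitaryPow (Equiv.mulRight a) (freeOrbits_mulRight ha) (-t)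

theorem commute_mulLeft_mulRight (a b : Γ) : Commute (Equiv.mulLeft a) (Equiv.mulRight b) := by
  ext g; simp [mul_assoc]

theorem conjPow_commute {a b : Γ} (ha : Injective fun n : ℤ => a ^ n)
    (hb : Injective fun n : ℤ => b ^ n) (t s : ℝ) (hab : Commute a b) :
    Commute (conjPow (K := K) a ha t) (conjPow (K := K) b hb s) := by
  have hl : Commute (Equiv.mulLeft a) (Equiv.mulLeft b) := by
    ext g; simp [← mul_assoc, hab.eq]
  have hr : Commute (Equiv.mulRight a) (Equiv.mulRight b) := by
    ext g; simp [mul_assoc, hab.eq]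
  unfold conjPow
  exact ((unitaryPow_commute _ _ _ _ _ _ hl).mul_right
      (unitaryPow_commute _ _ _ _ _ _ (commute_mulLeft_mulRight a b))).mul_left
    ((unitaryPow_commute _ _ _ _ _ _ (commute_mulLeft_mulRight b a).symm).mul_right
      (unitaryPow_commute _ _ _ _ _ _ hr))

theorem conjPow_single_of_commute {a : Γ} (ha : Injective fun n : ℤ => a ^ n) (t : ℝ) {g : Γ}
    (hag : Commute a g) (x : K) : conjPow a ha t (single g x) = single g x := by
  change unitaryPow _ (freeOrbits_mulLeft ha) t
    (unitaryPow _ (freeOrbits_mulRight ha) (-t) (single g x)) = _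
  have h : powSingle (K := K) _ (freeOrbits_mulRight ha) (-t) g x =
      powSingle _ (freeOrbits_mulLeft ha) (-t) g x := by
    refine (powSingle_hasSum _ (freeOrbits_mulRight ha) (-t) g x).unique ?_
    have h1 := powSingle_hasSum _ (freeOrbits_mulLeft ha) (-t) g x
    have h2 : ∀ n : ℤ, (Equiv.mulRight a ^ n) g = (Equiv.mulLeft a ^ n) g := by
      intro n
      simp [Equiv.zpow_mulLeft, Equiv.zpow_mulRight, (hag.zpow_left n).eq]
    simp_rw [h2]
    exact h1
  rw [unitaryPow_single, h, unitaryPow_neg_cancel]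

end Conjugation

/-! ## Restricted direct sums and wreath-like products -/

section Groups

/-- The restricted direct sum `A^{(I)}`: finitely supported functions `I → A`. -/
def FinSupp (I A : Type*) [Group A] : Subgroup (I → A) where
  carrier := {f | (mulSupport f).Finite}
  one_mem' := by simp
  mul_mem' {f g} hf hg := (hf.union hg).subset (mulSupport_mul f g)
  inv_mem' {f} hf := by simpa using hf

variable {I A A' B G : Type*} [Group A] [Group A'] [Group B] [Group G] [MulAction B I]

/-- The support of an element of `A^{(I)}`. -/
def supp (f : FinSupp I A) : Finset I := f.2.toFinset

theorem mem_supp (f : FinSupp I A) (i : I) : i ∈ supp f ↔ (f : I → A) i ≠ 1 := by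
  exact (Set.Finite.mem_toFinset _).trans mem_mulSupport

open Classical in
/-- The embedding of `A` into `A^{(I)}` as the `i`-th coordinate subgroup. -/
def FinSupp.coord (i : I) : A →* FinSupp I A where
  toFun a := ⟨Pi.mulSingle i a, (Set.finite_singleton i).subset Pi.mulSupport_mulSingle_subset⟩
  map_one' := by ext; simp
  map_mul' a b := by
    ext j
    simp [Pi.mulSingle_mul]

/-- The homomorphism `A^{(I)} → A'^{(I)}` induced by `A → A'`. -/
def FinSupp.map (I : Type*) (φ : A →* A') : FinSupp I A →* FinSupp I A' where
  toFun f := ⟨fun i => φ ((f : I → A) i), f.2.subset fun i hi h => hi (by simp [h])⟩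
  map_one' := by ext; simp
  map_mul' a b := by ext; simp

theorem FinSupp.map_injective (φ : A →* A') (hφ : Injective φ) : Injective (FinSupp.map I φ) := by
  intro f g h
  ext i
  exact hφ (congrFun (congrArg Subtype.val h) i)

/-- A wreath-like product of `A` and `B` corresponding to `B ↷ I`: a group `G` with an extension
`1 → A^{(I)} → G → B → 1` such that `g A_i g⁻¹ = A_{ε(g) i}`, where `A_i` is the `i`-th direct
summand. -/
structure WreathLikeProduct (A B I G : Type*) [Group A] [Group B] [Group G] [MulAction B I] where
  /-- the inclusion of the core -/
  incl : FinSupp I A →* G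
  incl_injective : Injective incl
  /-- the quotient map `ε` -/
  proj : G →* B
  proj_surjective : Surjective proj
  range_incl : incl.range = proj.ker
  conj_coord : ∀ (g : G) (i : I),
    (incl.comp (FinSupp.coord i)).range.map (MulAut.conj g).toMonoidHom =
      (incl.comp (FinSupp.coord (proj g • i))).range

/-- A set-theoretic section `ς : B → G` whose cocycle `α(x,y) = ς(x) ς(y) ς(xy)⁻¹` has uniformly
bounded supports. A wreath-like product has bounded cocycle if such a section exists. -/
structure WreathLikeProduct.BoundedSection (W : WreathLikeProduct A B I G) where
  toFun : B → G
  proj_toFun : ∀ b, W.proj (toFun b) = b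
  bounded : ∃ C : ℕ, ∀ x y, ∃ c : FinSupp I A,
    W.incl c = toFun x * toFun y * (toFun (x * y))⁻¹ ∧ (supp c).card ≤ C

variable {W : WreathLikeProduct A B I G}

open Classical in
/-- The representative `ς(b) ∈ G` of `b ∈ B`, where the neutral element is represented by `1`. -/
def WreathLikeProduct.BoundedSection.rep (ς : W.BoundedSection) (b : B) : G :=
  if b = 1 then 1 else ς.toFun b

theorem WreathLikeProduct.BoundedSection.exists_core (ς : W.BoundedSection) (g : G) :
    ∃ c : FinSupp I A, g = W.incl c * ς.rep (W.proj g) := by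
  have h : g * (ς.rep (W.proj g))⁻¹ ∈ W.incl.range := by
    rw [W.range_incl, MonoidHom.mem_ker, map_mul, map_inv, mul_inv_eq_one]
    unfold rep
    split_ifs with h
    · rw [h, map_one]
    · rw [ς.proj_toFun]
  obtain ⟨c, hc⟩ := h
  exact ⟨c, by rw [hc, inv_mul_cancel_right]⟩

/-- The component `c ∈ A^{(I)}` in the unique decomposition `g = c b` with `b ∈ B`. -/
def WreathLikeProduct.BoundedSection.core (ς : W.BoundedSection) (g : G) : FinSupp I A :=
  (ς.exists_core g).choose

open Classical in
/-- The support array `q : G → ℓ²(I)`: for `g = c b` with `c ∈ A^{(I)}` and `b ∈ B`, the vector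
`q(g)` is the indicator function of the support of `c`. -/
def WreathLikeProduct.BoundedSection.supportArray (ς : W.BoundedSection) (g : G) : L2 I ℝ :=
  ∑ i ∈ supp (ς.core g), lp.single 2 i (1 : ℝ)

end Groups

/-! ## Ioana's tensor-length deformation -/

section Ioana

variable {I A K : Type*} [Group A] [NormedAddCommGroup K] [InnerProductSpace ℂ K] [CompleteSpace K]

/-- The free product `A ∗ ℤ`. -/
abbrev FreeProdInt (A : Type*) [Group A] : Type _ := Monoid.Coprod A (Multiplicative ℤ)

/-- The canonical generator of `ℤ` in the `i`-th copy of `A ∗ ℤ` in `(A ∗ ℤ)^{(I)}`. -/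
def generator (A : Type*) [Group A] (i : I) : FinSupp I (FreeProdInt A) :=
  FinSupp.coord i (Monoid.Coprod.inr (Multiplicative.ofAdd (1 : ℤ)))

theorem generator_apply_self (i : I) : (generator A i : I → FreeProdInt A) i =
    Monoid.Coprod.inr (Multiplicative.ofAdd (1 : ℤ)) := by
  simp [generator, FinSupp.coord]

theorem generator_zpow_injective (i : I) : Injective fun n : ℤ => generator A i ^ n := by
  intro m n h
  have h1 := congrFun (congrArg Subtype.val h) i
  simp only [SubgroupClass.coe_zpow, Pi.pow_apply, generator_apply_self, ← map_zpow] at h1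
  have h2 := Monoid.Coprod.inr_injective h1
  simpa [← ofAdd_zsmul] using h2

theorem generator_commute (i : I) (g : FinSupp I (FreeProdInt A))
    (hg : (g : I → FreeProdInt A) i = 1) : Commute (generator A i) g := by
  ext j
  by_cases hj : j = i
  · subst hj; simp [hg]
  · simp [generator, FinSupp.coord, hj]

theorem generator_commute_generator {i j : I} (hij : i ≠ j) :
    Commute (generator A i) (generator A j) :=
  generator_commute i _ (by simp [generator, FinSupp.coord, hij])

theorem pairwise_commute_conjPow (t : ℝ) (F : Finset I) : (F : Set I).Pairwise
    (Commute on fun i => conjPow (K := K) (generator A i) (generator_zpow_injective i) t) :=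
  fun _ _ _ _ hij => conjPow_commute _ _ t t (generator_commute_generator hij)

/-- Conjugation by `∏_{i ∈ F} u_i^t`, where `u_i` is the canonical generating Haar unitary of `L(ℤ)`
in the `i`-th tensor factor `L(A ∗ ℤ)`; this is the tensor product of the automorphisms `Ad(u^t)`
over the factors in `F`. -/
def conjFinset (t : ℝ) (F : Finset I) :
    L2 (FinSupp I (FreeProdInt A)) K →ₗᵢ[ℂ] L2 (FinSupp I (FreeProdInt A)) K :=
  F.noncommProd (fun i => conjPow (generator A i) (generator_zpow_injective i) t)
    (pairwise_commute_conjPow t F)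

theorem conjFinset_single_of_disjoint (t : ℝ) (F : Finset I) (g : FinSupp I (FreeProdInt A)) (x : K)
    (h : ∀ i ∈ F, (g : I → FreeProdInt A) i = 1) : conjFinset t F (single g x) = single g x := by
  classical
  induction F using Finset.induction_on with
  | empty => rfl
  | insert i F hi ih =>
    have h1 : conjFinset (K := K) (A := A) t (insert i F) =
        conjPow (generator A i) (generator_zpow_injective i) t * conjFinset t F :=
      Finset.noncommProd_insert_of_notMem _ _ _ (pairwise_commute_conjPow t _) hi
    rw [h1, LinearIsometry.coe_mul, Function.comp_apply,
      ih fun j hj => h j (Finset.mem_insert_of_mem hj),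
      conjPow_single_of_commute (generator_zpow_injective i) t
        (generator_commute i g (h i (Finset.mem_insert_self i F))) x]

theorem conjFinset_single_of_subset (t : ℝ) (F : Finset I) (g : FinSupp I (FreeProdInt A)) (x : K)
    (h : supp g ⊆ F) : conjFinset t F (single g x) = conjFinset t (supp g) (single g x) := by
  classical
  have hd : Disjoint (supp g) (F \ supp g) := Finset.disjoint_sdiff
  have h1 : conjFinset (K := K) (A := A) t F =
      conjFinset t (supp g) * conjFinset t (F \ supp g) := by
    have h2 := Finset.noncommProd_union_of_disjoint hd _
      (pairwise_commute_conjPow (K := K) (A := A) t (supp g ∪ F \ supp g))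
    refine Eq.trans ?_ h2
    exact Finset.noncommProd_congr (Finset.union_sdiff_of_subset h).symm (fun _ _ => rfl) _
  rw [h1]
  change conjFinset t (supp g) (conjFinset t (F \ supp g) (single g x)) = _
  rw [conjFinset_single_of_disjoint t (F \ supp g)]
  intro i hi
  by_contra hne
  exact (Finset.mem_sdiff.1 hi).2 ((mem_supp g i).2 hne)

theorem orthogonalFamily_conjFinset (t : ℝ) : OrthogonalFamily ℂ
    (fun _ : FinSupp I (FreeProdInt A) => K) (fun g => (conjFinset t (supp g)).comp (single g)) := by
  classical
  intro g g' hne x y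
  change inner ℂ (conjFinset t (supp g) (single g x)) (conjFinset t (supp g') (single g' y)) = 0
  rw [← conjFinset_single_of_subset t (supp g ∪ supp g') g x Finset.subset_union_left,
    ← conjFinset_single_of_subset t (supp g ∪ supp g') g' y Finset.subset_union_right,
    LinearIsometry.inner_map_map, inner_single_left, single_apply, if_neg hne, inner_zero_right]

/-- Ioana's deformation `α_t` on `K ⊗ ℓ²((A ∗ ℤ)^{(I)})`, determined by
`α_t(x ⊗ (⊗_i a_i)) = x ⊗ (⊗_i u^t a_i (u^t)*)`. On the vector `x ⊗ δ_g` only the finitely many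
tensor factors `i` with `g_i ≠ 1` are affected. For `K = L²(N)` this is the extension
to `L²` of the trace-preserving automorphism `α_t` of `N ⊗ L((A ∗ ℤ)^{(I)})`. -/
def ioanaDeformation (t : ℝ) :
    L2 (FinSupp I (FreeProdInt A)) K →ₗᵢ[ℂ] L2 (FinSupp I (FreeProdInt A)) K :=
  (orthogonalFamily_conjFinset t).linearIsometry

/-- The inclusion `K ⊗ ℓ²(A^{(I)}) ⊆ K ⊗ ℓ²((A ∗ ℤ)^{(I)})`. -/
def inclIoana (I A K : Type*) [Group A] [NormedAddCommGroup K] [InnerProductSpace ℂ K]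
    [CompleteSpace K] : L2 (FinSupp I A) K →ₗᵢ[ℂ] L2 (FinSupp I (FreeProdInt A)) K :=
  l2map (FinSupp.map I Monoid.Coprod.inl)
    (FinSupp.map_injective _ Monoid.Coprod.inl_injective) fun _ => LinearIsometry.id

end Ioana

/-! ## The Gaussian deformation -/

section Gaussian
open ProbabilityTheory

variable {I K : Type*} [NormedAddCommGroup K] [InnerProductSpace ℂ K] [CompleteSpace K]

/-- The Gaussian probability space `(Y, ν)` of the real Hilbert space `ℓ²(I)`: the product
over `I` of standard Gaussian measures. -/
def gaussMeasure (I : Type*) : Measure (I → ℝ) := Measure.infinitePi fun _ => gaussianReal 0 1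

instance : IsProbabilityMeasure (gaussMeasure I) := by
  unfold gaussMeasure; infer_instance

theorem memLp_coord (i : I) : MemLp (fun y : I → ℝ => y i) 2 (gaussMeasure I) := by
  have h := measurePreserving_eval_infinitePi (fun _ : I => gaussianReal 0 1) i
  exact (memLp_id_gaussianReal' (μ := 0) (v := 1) 2 (by norm_num)).comp_measurePreserving h

/-- The coordinate functions as elements of `L²(Y, ν)`. -/
def coordLp (i : I) : Lp ℝ 2 (gaussMeasure I) := (memLp_coord i).toLp _

theorem inner_coordLp (i j : I) :
    inner ℝ (coordLp i) (coordLp j) = ∫ y, y i * y j ∂(gaussMeasure I) := by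
  rw [L2.inner_def]
  refine integral_congr_ae ?_
  filter_upwards [(memLp_coord i).coeFn_toLp, (memLp_coord j).coeFn_toLp] with y h1 h2
  rw [coordLp, coordLp, h1, h2, RCLike.inner_apply']
  simp

theorem integral_coord (i : I) (f : ℝ → ℝ) (hf : Measurable f) :
    ∫ y, f (y i) ∂(gaussMeasure I) = ∫ s, f s ∂(gaussianReal 0 1) := by
  have h := measurePreserving_eval_infinitePi (fun _ : I => gaussianReal 0 1) i
  have h2 : gaussianReal 0 1 = (gaussMeasure I).map (fun y => y i) := h.map_eq.symm
  rw [h2, integral_map (measurable_pi_apply i).aemeasurable hf.aestronglyMeasurable]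

theorem orthonormal_coordLp : Orthonormal ℝ (coordLp : I → Lp ℝ 2 (gaussMeasure I)) := by
  classical
  rw [orthonormal_iff_ite]
  intro i j
  rw [inner_coordLp]
  split_ifs with hij
  · subst hij
    rw [integral_coord i (fun s => s * s) (by fun_prop)]
    have h := variance_id_gaussianReal (μ := 0) (v := 1)
    rw [variance_of_integral_eq_zero (by fun_prop) (by simp [integral_id_gaussianReal])] at h
    simpa [sq] using h
  · have hind : iIndepFun (fun (i : I) (y : I → ℝ) => y i) (gaussMeasure I) :=
      iIndepFun_infinitePi (P := fun _ : I => gaussianReal 0 1) (X := fun _ => id)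
        (fun _ => measurable_id)
    have h := (hind.indepFun hij).integral_mul_eq_mul_integral
      (measurable_pi_apply i).aestronglyMeasurable (measurable_pi_apply j).aestronglyMeasurable
    have h0 : ∫ y, y i ∂(gaussMeasure I) = 0 := by
      rw [integral_coord i (fun s => s) measurable_id, integral_id_gaussianReal]
    simpa [h0] using h

/-- The isonormal Gaussian process `X : ℓ²(I) → L²(Y, ν)`, with `X(v) = ∑_i v_i y_i`. -/
def isonormal : L2 I ℝ →ₗᵢ[ℝ] Lp ℝ 2 (gaussMeasure I) :=
  (orthonormal_coordLp (I := I)).orthogonalFamily.linearIsometry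

/-- The unitaries `ω(v) = exp(i √2 X(v))` generating `L^∞(Y, ν)`. They satisfy
`ω(v + w) = ω(v) ω(w)`, `ω(v)* = ω(-v)` and `τ(ω(v)) = ∫ ω(v) dν = exp(-‖v‖²)`. -/
def gaussOmega (v : L2 I ℝ) (y : I → ℝ) : ℂ :=
  Complex.exp (Complex.I * ((Real.sqrt 2 * isonormal v y : ℝ) : ℂ))

theorem norm_gaussOmega (v : L2 I ℝ) (y : I → ℝ) : ‖gaussOmega v y‖ = 1 := by
  rw [gaussOmega, mul_comm, Complex.norm_exp_ofReal_mul_I]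

theorem aestronglyMeasurable_gaussOmega (v : L2 I ℝ) :
    AEStronglyMeasurable (gaussOmega v) (gaussMeasure I) := by
  have h : AEStronglyMeasurable (isonormal v) (gaussMeasure I) := Lp.aestronglyMeasurable _
  unfold gaussOmega
  exact Complex.continuous_exp.comp_aestronglyMeasurable
    ((Complex.continuous_ofReal.comp_aestronglyMeasurable (h.const_mul _)).const_mul _)

theorem memLp_gaussOmega_smul (v : L2 I ℝ) (f : Lp K 2 (gaussMeasure I)) :
    MemLp (fun y => gaussOmega v y • f y) 2 (gaussMeasure I) := by
  refine (Lp.memLp f).of_le ((aestronglyMeasurable_gaussOmega v).smul (Lp.aestronglyMeasurable f))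
    (ae_of_all _ fun y => ?_)
  rw [norm_smul, norm_gaussOmega, one_mul]

/-- Multiplication by `ω(v)` on `L²(Y, ν) ⊗ K = L²(Y, ν; K)`. -/
def mulOmega (v : L2 I ℝ) : Lp K 2 (gaussMeasure I) →ₗᵢ[ℂ] Lp K 2 (gaussMeasure I) where
  toFun f := (memLp_gaussOmega_smul v f).toLp _
  map_add' f g := by
    rw [← MemLp.toLp_add]
    refine MemLp.toLp_congr _ _ ?_
    filter_upwards [Lp.coeFn_add f g] with y hy
    change gaussOmega v y • (f + g : Lp K 2 (gaussMeasure I)) y = _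
    rw [hy]
    exact smul_add _ _ _
  map_smul' c f := by
    rw [RingHom.id_apply, ← MemLp.toLp_const_smul]
    refine MemLp.toLp_congr _ _ ?_
    filter_upwards [Lp.coeFn_smul c f] with y hy
    change gaussOmega v y • (c • f : Lp K 2 (gaussMeasure I)) y = _
    rw [hy]
    exact smul_comm _ _ _
  norm_map' f := by
    change ‖(memLp_gaussOmega_smul v f).toLp _‖ = ‖f‖
    rw [Lp.norm_toLp, Lp.norm_def]
    congr 1
    refine eLpNorm_congr_norm_ae (ae_of_all _ fun y => ?_)
    rw [norm_smul, norm_gaussOmega, one_mul]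

/-- The inclusion `K = 1 ⊗ K ⊆ L²(Y, ν) ⊗ K`. -/
def constLp (I K : Type*) [NormedAddCommGroup K] [InnerProductSpace ℂ K] :
    K →ₗᵢ[ℂ] Lp K 2 (gaussMeasure I) where
  toLinearMap := Lp.constₗ 2 (gaussMeasure I) ℂ
  norm_map' x := by
    change ‖Lp.const 2 (gaussMeasure I) x‖ = _
    rw [← MemLp.toLp_const, Lp.norm_toLp, eLpNorm_const _ (by norm_num) (NeZero.ne _)]
    simp

variable {A B G : Type*} [Group A] [Group B] [Group G] [MulAction B I]

/-- The Gaussian deformation `V_t^q` of `L²(Y, ν) ⊗ K ⊗ ℓ²(G)` associated with a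
map `q : G → ℓ²(I)`: `V_t^q (ζ ⊗ x ⊗ δ_h) = ω(t q(h)) ζ ⊗ x ⊗ δ_h`. -/
def gaussianDeformation (q : G → L2 I ℝ) (t : ℝ) :
    L2 G (Lp K 2 (gaussMeasure I)) →ₗᵢ[ℂ] L2 G (Lp K 2 (gaussMeasure I)) :=
  l2map id injective_id fun h => mulOmega (t • q h)

/-- The inclusion `K ⊗ ℓ²(A^{(I)}) = 1 ⊗ K ⊗ ℓ²(A^{(I)}) ⊆ L²(Y, ν) ⊗ K ⊗ ℓ²(G)`. -/
def inclGaussian (K : Type*) [NormedAddCommGroup K] [InnerProductSpace ℂ K] [CompleteSpace K]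
    (W : WreathLikeProduct A B I G) :
    L2 (FinSupp I A) K →ₗᵢ[ℂ] L2 G (Lp K 2 (gaussMeasure I)) :=
  l2map W.incl W.incl_injective fun _ => constLp I K

end Gaussian

/-! ## Tracial von Neumann algebras -/

/-- `τ` is a faithful normal tracial state. -/
structure IsFaithfulNormalTracialState {N : Type*} [CStarAlgebra N] [PartialOrder N]
    [StarOrderedRing N] (τ : N →ₚ[ℂ] ℂ) : Prop where
  map_one : τ 1 = 1
  trace : ∀ x y, τ (x * y) = τ (y * x)
  faithful : ∀ x, τ (star x * x) = 0 → x = 0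
  normal : ∀ (S : Set N) (a : N), S.Nonempty → DirectedOn (· ≤ ·) S → IsLUB S a →
    IsLUB (τ '' S) (τ a)

end WreathDeformation

end

open WreathDeformation

/-! Compressed to L²(M), each deformation is a diagonal multiplier depending only on the size of the
support of g ∈ A^{(I)}.

Gaussian side: V_s multiplies the g-component by ω(s·1_{supp g}). Compressing to 1 ⊗ K integrates
this function, and by independence of the coordinates the integral is exp(-s²)^{|supp g|}
(`adjoint_inclGaussian_apply`).

Ioana's side: for 1 ≠ a ∈ A, expand u^t a (u^t)* = ∑ c_n(t) c_m(-t) u^n a u^m. In A ∗ ℤ the word u^n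
a u^m lies in A only for n = m = 0, so the component in L(A) is c_0(t) c_0(-t) a, where c_0(t) =
sinc(πt) is the trace of u^t. The trivial element of A is fixed. Over the tensor factors this gives
the multiplier (sinc²(πt))^{|supp g|} (`adjoint_inclIoana_apply`).

Both deformations are isometries, so by Pythagoras the component orthogonal to L²(M) is larger
exactly when the compressed vector is smaller. The theorem therefore reduces to comparing the two
numbers exp(-s²) and sinc²(πt). With x = πt ∈ [0, 1], this is settled by exp(-x²/4) ≤ sinc x ≤
exp(-x²/6) (`exp_le_sinc`, `sinc_le_exp`). -/

namespace WreathDeformation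

/-! ## Comparison of projections onto complements -/

section Comparison

variable {H K K₁ K₂ Γ : Type*} [NormedAddCommGroup H] [InnerProductSpace ℂ H] [CompleteSpace H]
  [NormedAddCommGroup K] [InnerProductSpace ℂ K] [CompleteSpace K]
  [NormedAddCommGroup K₁] [InnerProductSpace ℂ K₁] [CompleteSpace K₁]
  [NormedAddCommGroup K₂] [InnerProductSpace ℂ K₂] [CompleteSpace K₂]

theorem perpProj_eq_sub (ι : H →ₗᵢ[ℂ] K) (w : K) :
    perpProj ι w = w - ι (ι.toContinuousLinearMap.adjoint w) := by
  set a := ι.toContinuousLinearMap.adjoint w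
  have h : w - ι a ∈ (LinearMap.range ι.toLinearMap)ᗮ := by
    rw [Submodule.mem_orthogonal]
    rintro _ ⟨x, rfl⟩
    have h1 : inner ℂ (ι x) w = inner ℂ x a :=
      (ContinuousLinearMap.adjoint_inner_right ι.toContinuousLinearMap x w).symm
    change inner ℂ (ι x) (w - ι a) = 0
    rw [inner_sub_right, LinearIsometry.inner_map_map, h1, sub_self]
  refine Submodule.eq_starProjection_of_mem_of_inner_eq_zero h fun z hz => ?_
  rw [sub_sub_cancel]
  exact hz _ ⟨a, rfl⟩

theorem norm_perpProj_sq (ι : H →ₗᵢ[ℂ] K) (w : K) :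
    ‖perpProj ι w‖ ^ 2 = ‖w‖ ^ 2 - ‖ι.toContinuousLinearMap.adjoint w‖ ^ 2 := by
  rw [perpProj_eq_sub]
  set a := ι.toContinuousLinearMap.adjoint w with ha
  have h1 : inner ℂ w (ι a) = inner ℂ a a :=
    (ContinuousLinearMap.adjoint_inner_left ι.toContinuousLinearMap a w).symm
  rw [@norm_sub_sq ℂ, h1, inner_self_eq_norm_sq, ι.norm_map]
  ring

/-- The squared distance to the range of ι is ‖w‖² - ‖ι* w‖², so for vectors of equal norm the
inequality between the compressions reverses. Coordinatewise domination suffices because the norm of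
ℓ²(Γ) is monotone in the norms of the coordinates. -/
theorem norm_perpProj_le (ι₁ : L2 Γ H →ₗᵢ[ℂ] K₁) (ι₂ : L2 Γ H →ₗᵢ[ℂ] K₂) (w₁ : K₁) (w₂ : K₂)
    (hw : ‖w₁‖ = ‖w₂‖)
    (h : ∀ g, ‖ι₂.toContinuousLinearMap.adjoint w₂ g‖ ≤ ‖ι₁.toContinuousLinearMap.adjoint w₁ g‖) :
    ‖perpProj ι₁ w₁‖ ≤ ‖perpProj ι₂ w₂‖ := by
  have h1 : ‖ι₂.toContinuousLinearMap.adjoint w₂‖ ≤ ‖ι₁.toContinuousLinearMap.adjoint w₁‖ :=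
    lp.norm_mono (by norm_num) h
  refine le_of_sq_le_sq ?_ (norm_nonneg _)
  rw [norm_perpProj_sq, norm_perpProj_sq, hw]
  gcongr

end Comparison

/-! ## The cardinal sine -/

section Sinc
open Real

/-- This coefficient is the trace of u^t, the mean of exp(itθ) over [-π, π]. -/
theorem powCoeff_zero (t : ℝ) : powCoeff t 0 = ((sinc (π * t) : ℝ) : ℂ) := by
  by_cases ht : t = 0
  · subst ht
    have h := powCoeff_int 0
    simpa using h
  · have h1 : ∀ θ : ℝ, Complex.exp (Complex.I * (t : ℂ) * θ) *
        Complex.exp (-(Complex.I * ((0 : ℤ) : ℂ) * θ)) = Complex.exp (Complex.I * t * θ) := by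
      intro θ; simp
    have hc : (t : ℂ) ≠ 0 := by exact_mod_cast ht
    have hp : (π : ℂ) ≠ 0 := by exact_mod_cast pi_ne_zero
    unfold powCoeff
    simp_rw [h1]
    rw [integral_exp_mul_complex (mul_ne_zero Complex.I_ne_zero hc),
      sinc_of_ne_zero (mul_ne_zero pi_ne_zero ht)]
    push_cast
    have e1 : Complex.I * (t : ℂ) * π = (π * t : ℂ) * Complex.I := by ring
    have e2 : Complex.I * (t : ℂ) * -π = (-(π * t) : ℂ) * Complex.I := by ring
    rw [e1, e2, Complex.exp_mul_I, Complex.exp_mul_I, Complex.cos_neg, Complex.sin_neg]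
    have hI := Complex.I_ne_zero
    field_simp
    ring

/-- Both sides agree to second order at 0, so the fourth-order terms decide: 1/120 for sinc against
1/72 for the exponential. The rational bounds in the proof keep them apart at 1/100. -/
theorem sinc_le_exp {x : ℝ} (h0 : 0 ≤ x) (h1 : x ≤ 1) : sinc x ≤ exp (-(x ^ 2 / 6)) := by
  rcases h0.eq_or_lt with rfl | hx
  · simp
  have hb := (abs_le.1 (sin_bound (x := x) (by rwa [abs_of_pos hx]))).2
  rw [abs_of_pos hx] at hb
  have hs : sinc x ≤ 1 - x ^ 2 / 6 + x ^ 4 / 100 := by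
    rw [sinc_of_ne_zero hx.ne', div_le_iff₀ hx]
    linarith
  have hx2 : x ^ 2 ≤ 1 := pow_le_one₀ h0 h1
  -- The x⁴ coefficient of (1 - x²/(6n))^n is (n - 1)/(72n), and n = 4 is the first value for which
  -- it exceeds 1/100. The loss from the x⁶ term is absorbed by x⁶ ≤ x⁴, since 1/96 - 1/3456 >
  -- 1/100.
  have he : (1 - x ^ 2 / 24) ^ 4 ≤ exp (-(x ^ 2 / 6)) := by
    have h2 : 1 - x ^ 2 / 24 ≤ exp (-(x ^ 2 / 24)) := one_sub_le_exp_neg _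
    calc (1 - x ^ 2 / 24) ^ 4 ≤ exp (-(x ^ 2 / 24)) ^ 4 :=
          pow_le_pow_left₀ (by linarith) h2 4
      _ = exp (-(x ^ 2 / 6)) := by
          rw [← exp_nat_mul]
          congr 1
          push_cast
          ring
  refine hs.trans (le_trans ?_ he)
  have h6 : x ^ 6 ≤ x ^ 4 := pow_le_pow_of_le_one h0 h1 (by norm_num)
  nlinarith [pow_nonneg h0 8, pow_nonneg h0 4]

/-- The product (1 - x²/6)(1 + x²/4) = 1 + x²/12 - x⁴/24 is at least 1 when x² ≤ 2, which puts 1 -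
x²/6 between exp(-x²/4) and sinc x. The rate 1/4 is not optimal, but it leaves enough room for the
constant in the theorem. -/
theorem exp_le_sinc {x : ℝ} (h0 : 0 ≤ x) (h1 : x ≤ 1) : exp (-(x ^ 2 / 4)) ≤ sinc x := by
  rcases h0.eq_or_lt with rfl | hx
  · simp
  have hs : 1 - x ^ 2 / 6 ≤ sinc x := by
    rw [sinc_of_ne_zero hx.ne', le_div_iff₀ hx]
    linarith [sin_ge_sub_cube h0]
  refine le_trans ?_ hs
  have h2 : 1 + x ^ 2 / 4 ≤ exp (x ^ 2 / 4) := by linarith [add_one_le_exp (x ^ 2 / 4)]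
  have hx2 : x ^ 2 ≤ 1 := pow_le_one₀ h0 h1
  rw [exp_neg, inv_le_comm₀ (exp_pos _) (by linarith)]
  refine le_trans ?_ h2
  rw [inv_le_iff_one_le_mul₀ (by linarith)]
  nlinarith [sq_nonneg x]

end Sinc

/-! ## The Gaussian deformation -/

section Gaussian
open ProbabilityTheory

variable {A B G I K : Type*} [Group A] [Group B] [Group G] [MulAction B I]
  [NormedAddCommGroup K] [InnerProductSpace ℂ K] [CompleteSpace K]

theorem isonormal_single [DecidableEq I] (i : I) (s : ℝ) :
    isonormal (lp.single 2 i s : L2 I ℝ) = s • coordLp i := by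
  have h := (orthonormal_coordLp (I := I)).orthogonalFamily.linearIsometry_apply_single (i := i) s
  convert h using 1
  · congr!
  · exact (LinearIsometry.toSpanSingleton_apply _ _).symm

theorem isonormal_indicator [DecidableEq I] (F : Finset I) (s : ℝ) :
    isonormal (s • ∑ i ∈ F, lp.single 2 i (1 : ℝ) : L2 I ℝ) =ᵐ[gaussMeasure I]
      fun y => ∑ i ∈ F, s * y i := by
  have h : isonormal (s • ∑ i ∈ F, lp.single 2 i (1 : ℝ) : L2 I ℝ) =
      ∑ i ∈ F, ((memLp_coord i).const_mul s).toLp _ := by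
    rw [map_smul, map_sum, Finset.smul_sum]
    refine Finset.sum_congr rfl fun i _ => ?_
    rw [isonormal_single, one_smul]
    rfl
  rw [h]
  refine (Lp.coeFn_finsetSum _ _).trans ?_
  have h2 : ∀ᵐ y ∂(gaussMeasure I), ∀ i ∈ F, ((memLp_coord i).const_mul s).toLp _ y = s * y i :=
    (Finset.eventually_all F).2 fun i _ => MemLp.coeFn_toLp _
  filter_upwards [h2] with y hy
  rw [Finset.sum_apply]
  exact Finset.sum_congr rfl hy

/-- The integrand is a product of functions of distinct coordinates, so the product measure splits
the integral. Each factor is the characteristic function exp(-r²/2) of the standard Gaussian at r =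
√2 s, namely exp(-s²). -/
theorem integral_gaussOmega_indicator [DecidableEq I] (F : Finset I) (s : ℝ) :
    ∫ y, gaussOmega (s • ∑ i ∈ F, lp.single 2 i (1 : ℝ)) y ∂(gaussMeasure I) =
      ((Real.exp (-s ^ 2) ^ F.card : ℝ) : ℂ) := by
  have h1 : ∫ y, gaussOmega (s • ∑ i ∈ F, lp.single 2 i (1 : ℝ)) y ∂(gaussMeasure I) =
      ∫ y, (fun z : F → ℝ => ∏ i : F, Complex.exp (((Real.sqrt 2 * s : ℝ) : ℂ) * z i * Complex.I))
        (F.restrict y) ∂(gaussMeasure I) := by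
    refine integral_congr_ae ?_
    filter_upwards [isonormal_indicator F s] with y hy
    rw [gaussOmega, hy, ← Complex.exp_sum, ← Finset.sum_coe_sort F]
    congr 1
    push_cast
    rw [Finset.mul_sum, Finset.mul_sum]
    refine Finset.sum_congr rfl fun i _ => ?_
    simp only [Finset.restrict]
    ring
  have h2 : ∫ z : ℝ, Complex.exp (((Real.sqrt 2 * s : ℝ) : ℂ) * z * Complex.I)
      ∂(gaussianReal 0 1) = ((Real.exp (-s ^ 2) : ℝ) : ℂ) := by
    rw [← charFun_apply_real, charFun_gaussianReal, Complex.ofReal_exp]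
    congr 1
    have : ((Real.sqrt 2 : ℝ) : ℂ) ^ 2 = 2 := by
      rw [← Complex.ofReal_pow, Real.sq_sqrt (by norm_num)]
      norm_num
    push_cast
    rw [mul_pow, this]
    simp
  have h3 := integral_restrict_infinitePi (μ := fun _ : I => gaussianReal 0 1) (s := F)
    (f := fun z : F → ℝ => ∏ i : F, Complex.exp (((Real.sqrt 2 * s : ℝ) : ℂ) * z i * Complex.I))
    (Measurable.aestronglyMeasurable (by fun_prop))
  rw [h1]
  refine h3.trans ?_
  rw [integral_fintype_prod_eq_prod
    (f := fun (_ : F) (z : ℝ) => Complex.exp (((Real.sqrt 2 * s : ℝ) : ℂ) * z * Complex.I))]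
  simp_rw [h2]
  simp

/-- Compressing multiplication by ω(v) to the constants 1 ⊗ K leaves only its mean. -/
theorem inner_constLp_mulOmega (v : L2 I ℝ) (x y : K) :
    inner ℂ (constLp I K x) (mulOmega v (constLp I K y)) =
      (∫ z, gaussOmega v z ∂(gaussMeasure I)) * inner ℂ x y := by
  rw [L2.inner_def, ← integral_mul_const]
  refine integral_congr_ae ?_
  filter_upwards [(memLp_gaussOmega_smul v (constLp I K y)).coeFn_toLp,
    Lp.coeFn_const 2 (gaussMeasure I) x, Lp.coeFn_const 2 (gaussMeasure I) y] with z h1 h2 h3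
  have e1 : mulOmega v (constLp I K y) z = gaussOmega v z • y := by
    refine h1.trans ?_
    congr 1
  have e2 : constLp I K x z = x := h2
  rw [e1, e2, inner_smul_right]

/-- Here the normalisation of the representative of 1 ∈ B as 1 ∈ G matters: without it, the core of
an element of A^{(I)} would be shifted by the value of the section at 1. As a result, the support
array restricted to A^{(I)} is the indicator of the support. -/
theorem core_incl {W : WreathLikeProduct A B I G} (ς : W.BoundedSection) (f : FinSupp I A) :
    ς.core (W.incl f) = f := by
  have h : W.incl f = W.incl (ς.core (W.incl f)) * ς.rep (W.proj (W.incl f)) :=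
    (ς.exists_core (W.incl f)).choose_spec
  have h1 : W.proj (W.incl f) = 1 := by
    rw [← MonoidHom.mem_ker, ← W.range_incl]
    exact ⟨f, rfl⟩
  rw [h1] at h
  simp only [WreathLikeProduct.BoundedSection.rep, if_true, mul_one] at h
  exact (W.incl_injective h).symm

theorem adjoint_inclGaussian_apply {W : WreathLikeProduct A B I G} (ς : W.BoundedSection) (s : ℝ)
    (ξ : L2 (FinSupp I A) K) (g : FinSupp I A) :
    (inclGaussian K W).toContinuousLinearMap.adjoint
        (gaussianDeformation ς.supportArray s (inclGaussian K W ξ)) g =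
      ((Real.exp (-s ^ 2) ^ (supp g).card : ℝ) : ℂ) • ξ g := by
  classical
  refine ext_inner_left ℂ fun x => ?_
  rw [← inner_single_left, ContinuousLinearMap.adjoint_inner_right]
  change inner ℂ (inclGaussian K W (single g x)) _ = _
  rw [inclGaussian, l2map_single, inner_single_left, gaussianDeformation]
  have h := l2map_apply id injective_id (fun h => mulOmega (K := K) (s • ς.supportArray h))
    (l2map W.incl W.incl_injective (fun _ => constLp I K) ξ) (W.incl g)
  rw [id] at h
  rw [h, l2map_apply, inner_constLp_mulOmega, inner_smul_right,
    WreathLikeProduct.BoundedSection.supportArray, core_incl, ← integral_gaussOmega_indicator]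

end Gaussian

/-! ## Ioana's deformation -/

section Ioana

/-- `A ∗ ℤ` acting on `ℤ × A`: the group `A` by left translation of `{0} × A`, and `ℤ` by
translation of the first coordinate. -/
noncomputable def shiftAction (A : Type*) [Group A] : FreeProdInt A →* Equiv.Perm (ℤ × A) :=
  Monoid.Coprod.lift
    { toFun := fun a => Equiv.Perm.prodExtendRight (0 : ℤ) (Equiv.mulLeft a)
      map_one' := by
        ext ⟨k, x⟩ <;> by_cases hk : k = 0 <;> simp [Equiv.Perm.prodExtendRight, hk]
      map_mul' := fun a b => by
        ext ⟨k, x⟩ <;> by_cases hk : k = 0 <;> simp [Equiv.Perm.prodExtendRight, hk] }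
    (zpowersHom _ (Equiv.prodCongr (Equiv.addRight (1 : ℤ)) (Equiv.refl A)))

variable {A I K : Type*} [Group A] [NormedAddCommGroup K] [InnerProductSpace ℂ K] [CompleteSpace K]

theorem shiftAction_inl (a : A) (k : ℤ) (x : A) :
    shiftAction A (Monoid.Coprod.inl a) (k, x) = (k, if k = 0 then a * x else x) := by
  by_cases hk : k = 0 <;> simp [shiftAction, Equiv.Perm.prodExtendRight, hk]

theorem shiftAction_inr (n k : ℤ) (x : A) :
    shiftAction A (Monoid.Coprod.inr (Multiplicative.ofAdd (1 : ℤ)) ^ n) (k, x) = (k + n, x) := by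
  have h : ∀ k, shiftAction A (Monoid.Coprod.inr (Multiplicative.ofAdd (1 : ℤ))) (k, x) =
      (k + 1, x) := by
    intro k
    simp [shiftAction]
  rw [map_zpow]
  induction n using Int.induction_on generalizing k with
  | zero => simp
  | succ n ih => rw [zpow_add_one, Equiv.Perm.mul_apply, h, ih]; ring_nf
  | pred n ih =>
    rw [zpow_sub_one, Equiv.Perm.mul_apply]
    have : (shiftAction A (Monoid.Coprod.inr (Multiplicative.ofAdd (1 : ℤ))))⁻¹ (k, x) =
        (k - 1, x) := by
      rw [Equiv.Perm.inv_eq_iff_eq, h, sub_add_cancel]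
    rw [this, ih]
    ring_nf

/-- Let both words act on (0, 1) through `shiftAction`. The right side gives (0, b). On the left,
u^m moves the point to (m, 1). If m ≠ 0 then a fixes it there, and the second coordinate stays 1 ≠
b. So m = 0, and comparing first coordinates gives n = 0. -/
theorem eq_zero_of_zpow_mul_inl_mul_zpow {a b : A} (hb : b ≠ 1) {n m : ℤ}
    (h : Monoid.Coprod.inr (Multiplicative.ofAdd (1 : ℤ)) ^ n * Monoid.Coprod.inl a *
      Monoid.Coprod.inr (Multiplicative.ofAdd (1 : ℤ)) ^ m =
        (Monoid.Coprod.inl b : FreeProdInt A)) : n = 0 ∧ m = 0 := by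
  have h1 := congrArg (fun w => shiftAction A w ((0 : ℤ), (1 : A))) h
  simp only [map_mul, Equiv.Perm.mul_apply, shiftAction_inr, shiftAction_inl, zero_add,
    if_true, mul_one, Prod.mk.injEq] at h1
  obtain ⟨h2, h3⟩ := h1
  by_cases hm : m = 0
  · exact ⟨by omega, hm⟩
  · rw [if_neg hm] at h3
    exact absurd h3.symm hb

theorem generator_apply_of_ne {i j : I} (h : j ≠ i) :
    (generator A i : I → FreeProdInt A) j = 1 := by
  simp [generator, FinSupp.coord, h]

/-- The value at k is the iterated sum of c_n(t) c_m(-t) f(a^{-n} k a^{-m}), and the hypothesis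
leaves only the term n = m = 0. Left and right powers are summed one after the other, each sum
having at most one nonzero term. -/
theorem conjPow_apply_of_forall {Γ : Type*} [Group Γ] {a : Γ} (ha : Injective fun n : ℤ => a ^ n)
    (t : ℝ) (f : L2 Γ K) (k : Γ)
    (h : ∀ n m : ℤ, f (a ^ n * k * a ^ m) ≠ 0 → n = 0 ∧ m = 0) :
    conjPow a ha t f k = (powCoeff t 0 * powCoeff (-t) 0) • f k := by
  have hr : ∀ n : ℤ, unitaryPow (Equiv.mulRight a) (freeOrbits_mulRight ha) (-t) f (a ^ n * k) =
      if n = 0 then powCoeff (-t) 0 • f k else 0 := by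
    intro n
    refine (hasSum_unitaryPow_apply _ _ (-t) f (a ^ n * k)).unique ?_
    convert hasSum_ite_eq (0 : ℤ) (if n = 0 then powCoeff (-t) 0 • f k else 0) using 2 with m
    rw [Equiv.zpow_mulRight, Equiv.coe_mulRight]
    by_cases hf : f (a ^ n * k * a ^ (-m)) = 0
    · rw [hf, smul_zero]
      split_ifs with hm hn
      · subst hm hn
        simp only [zpow_zero, one_mul, neg_zero, mul_one] at hf
        rw [hf, smul_zero]
      all_goals rfl
    · obtain ⟨hn, hm⟩ := h n (-m) hf
      rw [neg_eq_zero] at hm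
      subst hn hm
      simp
  refine (hasSum_unitaryPow_apply _ (freeOrbits_mulLeft ha) t
    (unitaryPow (Equiv.mulRight a) (freeOrbits_mulRight ha) (-t) f) k).unique ?_
  convert hasSum_ite_eq (0 : ℤ) ((powCoeff t 0 * powCoeff (-t) 0) • f k) using 2 with n
  rw [Equiv.zpow_mulLeft, Equiv.coe_mulLeft, hr]
  by_cases hn : n = 0
  · simp [hn, mul_smul]
  · simp [hn]

theorem conjPow_apply_eq_zero {Γ : Type*} [Group Γ] {a : Γ} (ha : Injective fun n : ℤ => a ^ n)
    (t : ℝ) (f : L2 Γ K) (k : Γ) (h : ∀ n m : ℤ, f (a ^ n * k * a ^ m) = 0) :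
    conjPow a ha t f k = 0 := by
  refine (hasSum_unitaryPow_apply _ (freeOrbits_mulLeft ha) t
    (unitaryPow (Equiv.mulRight a) (freeOrbits_mulRight ha) (-t) f) k).unique ?_
  convert (hasSum_zero : HasSum (fun _ : ℤ => (0 : K)) 0) using 2 with n
  rw [Equiv.zpow_mulLeft, Equiv.coe_mulLeft]
  refine (congrArg _ ?_).trans (smul_zero _)
  refine (hasSum_unitaryPow_apply _ _ (-t) f (a ^ (-n) * k)).unique ?_
  convert (hasSum_zero : HasSum (fun _ : ℤ => (0 : K)) 0) using 2 with m
  rw [Equiv.zpow_mulRight, Equiv.coe_mulRight, h, smul_zero]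

theorem conjFinset_insert [DecidableEq I] (t : ℝ) {F : Finset I} {i : I} (hi : i ∉ F)
    (f : L2 (FinSupp I (FreeProdInt A)) K) : conjFinset t (insert i F) f =
      conjPow (generator A i) (generator_zpow_injective i) t (conjFinset t F f) := by
  have h1 : conjFinset (K := K) (A := A) t (insert i F) =
      conjPow (generator A i) (generator_zpow_injective i) t * conjFinset t F :=
    Finset.noncommProd_insert_of_notMem _ _ _ (pairwise_commute_conjPow t _) hi
  rw [h1]
  rfl

/-- Multiplying by powers of the generators at i ∈ F does not touch the coordinate j ∉ F, so the
image of x ⊗ δ_g is supported on elements that agree with g at j. -/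
theorem conjFinset_single_apply_eq_zero (t : ℝ) (F : Finset I) (g : FinSupp I (FreeProdInt A))
    (x : K) (k : FinSupp I (FreeProdInt A)) (j : I) (hj : j ∉ F)
    (hk : (k : I → FreeProdInt A) j ≠ (g : I → FreeProdInt A) j) :
    conjFinset t F (single g x) k = 0 := by
  classical
  induction F using Finset.induction_on generalizing k with
  | empty =>
    change single g x k = 0
    rw [single_apply, if_neg]
    rintro rfl
    exact hk rfl
  | insert i F hi ih =>
    rw [Finset.mem_insert, not_or] at hj
    rw [conjFinset_insert t hi]
    refine conjPow_apply_eq_zero _ t _ k fun n m => ih _ hj.2 ?_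
    simpa [generator_apply_of_ne hj.1] using hk

/-- Each coordinate where g is nontrivial contributes one factor c_0(t) c_0(-t). Letting F range
over subsets of the support of a fixed g allows the coordinates to be treated one at a time. -/
theorem conjFinset_single_apply (t : ℝ) (F : Finset I) (g k : FinSupp I A) (x : K)
    (hF : F ⊆ supp g) :
    conjFinset t F (single (FinSupp.map I Monoid.Coprod.inl g) x)
        (FinSupp.map I Monoid.Coprod.inl k) =
      (powCoeff t 0 * powCoeff (-t) 0) ^ F.card •
        single (FinSupp.map I Monoid.Coprod.inl g) x
          (FinSupp.map I (Monoid.Coprod.inl : A →* FreeProdInt A) k) := by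
  classical
  induction F using Finset.induction_on with
  | empty => rw [Finset.card_empty, pow_zero, one_smul]; rfl
  | insert i F hi ih =>
    rw [conjFinset_insert t hi, conjPow_apply_of_forall, ih ((Finset.subset_insert i F).trans hF),
      smul_smul, Finset.card_insert_of_notMem hi, pow_succ']
    intro n m hnm
    have h1 : (g : I → A) i ≠ 1 := (mem_supp g i).1 (hF (Finset.mem_insert_self i F))
    by_contra hne
    -- Since i ∉ F, the inner vector is nonzero at u_i^n k u_i^m only if the i-th coordinate u^n k_i
    -- u^m equals g_i. As g_i ≠ 1, the free product then forces n = m = 0.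
    refine hnm (conjFinset_single_apply_eq_zero t F _ x _ i hi fun heq => hne ?_)
    refine eq_zero_of_zpow_mul_inl_mul_zpow (a := (k : I → A) i) h1 ?_
    simpa [FinSupp.map, generator_apply_self] using heq

theorem supp_map_inl (g : FinSupp I A) :
    supp (FinSupp.map I (Monoid.Coprod.inl : A →* FreeProdInt A) g) = supp g := by
  ext i
  rw [mem_supp, mem_supp]
  change Monoid.Coprod.inl ((g : I → A) i) ≠ 1 ↔ _
  rw [ne_eq, ne_eq, map_eq_one_iff _ Monoid.Coprod.inl_injective]

theorem ioanaDeformation_single (t : ℝ) (g : FinSupp I (FreeProdInt A)) (x : K) :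
    ioanaDeformation t (single g x) = conjFinset t (supp g) (single g x) := by
  let : DecidableEq (FinSupp I (FreeProdInt A)) := fun a b => Classical.propDecidable (a = b)
  exact (orthogonalFamily_conjFinset t).linearIsometry_apply_single x

/-- Expand ξ in its components x ⊗ δ_g. Inside A^{(I)} the deformation is diagonal, so only g = k
contributes. -/
theorem ioanaDeformation_inclIoana_apply (t : ℝ) (ξ : L2 (FinSupp I A) K) (k : FinSupp I A) :
    ioanaDeformation t (inclIoana I A K ξ)
        (FinSupp.map I (Monoid.Coprod.inl : A →* FreeProdInt A) k) =
      (powCoeff t 0 * powCoeff (-t) 0) ^ (supp k).card • ξ k := by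
  classical
  have h := ((l2map_hasSum (FinSupp.map I (Monoid.Coprod.inl : A →* FreeProdInt A))
    (FinSupp.map_injective _ Monoid.Coprod.inl_injective)
    (fun _ => LinearIsometry.id (R := ℂ) (E := K)) ξ).mapL
      (ioanaDeformation t).toContinuousLinearMap).mapL
        (evalL (FinSupp.map I (Monoid.Coprod.inl : A →* FreeProdInt A) k))
  refine h.unique ?_
  convert hasSum_ite_eq k ((powCoeff t 0 * powCoeff (-t) 0) ^ (supp k).card • ξ k) using 2 with g
  change ioanaDeformation t (single _ (ξ g)) _ = _
  rw [ioanaDeformation_single, supp_map_inl, conjFinset_single_apply t _ g k _ subset_rfl,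
    single_apply]
  by_cases hg : g = k
  · subst hg; simp
  · rw [if_neg hg, if_neg, smul_zero]
    intro hk
    exact hg (FinSupp.map_injective _ Monoid.Coprod.inl_injective hk).symm

theorem adjoint_inclIoana_apply (t : ℝ) (ξ : L2 (FinSupp I A) K) (g : FinSupp I A) :
    (inclIoana I A K).toContinuousLinearMap.adjoint
        (ioanaDeformation t (inclIoana I A K ξ)) g =
      (((Real.sinc (Real.pi * t) ^ 2) ^ (supp g).card : ℝ) : ℂ) • ξ g := by
  refine ext_inner_left ℂ fun x => ?_
  rw [← inner_single_left, ContinuousLinearMap.adjoint_inner_right]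
  change inner ℂ (inclIoana I A K (single g x)) _ = _
  rw [inclIoana, l2map_single, inner_single_left, ← inclIoana, ioanaDeformation_inclIoana_apply,
    powCoeff_zero, powCoeff_zero, mul_neg, Real.sinc_neg]
  push_cast
  rw [sq]
  rfl

end Ioana

/-! ## Comparison of the two deformations -/

section Main

variable {A B G I K : Type*} [Group A] [Group B] [Group G] [MulAction B I]
  [NormedAddCommGroup K] [InnerProductSpace ℂ K] [CompleteSpace K]
  {W : WreathLikeProduct A B I G}

/-- Both multipliers are powers with the same exponent |supp g|, so comparing the nonnegative bases
is enough for all g at once. -/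
theorem norm_perpProj_gaussian_le (ς : W.BoundedSection) (ξ : L2 (FinSupp I A) K) (t s : ℝ)
    (h : Real.sinc (Real.pi * t) ^ 2 ≤ Real.exp (-s ^ 2)) :
    ‖perpProj (inclGaussian K W) (gaussianDeformation ς.supportArray s (inclGaussian K W ξ))‖ ≤
      ‖perpProj (inclIoana I A K) (ioanaDeformation t (inclIoana I A K ξ))‖ := by
  refine norm_perpProj_le _ _ _ _ (by simp only [LinearIsometry.norm_map]) fun g => ?_
  rw [adjoint_inclIoana_apply, adjoint_inclGaussian_apply, norm_smul, norm_smul,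
    Complex.norm_of_nonneg (by positivity), Complex.norm_of_nonneg (by positivity)]
  gcongr

theorem norm_perpProj_ioana_le (ς : W.BoundedSection) (ξ : L2 (FinSupp I A) K) (t s : ℝ)
    (h : Real.exp (-s ^ 2) ≤ Real.sinc (Real.pi * t) ^ 2) :
    ‖perpProj (inclIoana I A K) (ioanaDeformation t (inclIoana I A K ξ))‖ ≤
      ‖perpProj (inclGaussian K W)
        (gaussianDeformation ς.supportArray s (inclGaussian K W ξ))‖ := by
  refine norm_perpProj_le _ _ _ _ (by simp only [LinearIsometry.norm_map]) fun g => ?_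
  rw [adjoint_inclIoana_apply, adjoint_inclGaussian_apply, norm_smul, norm_smul,
    Complex.norm_of_nonneg (by positivity), Complex.norm_of_nonneg (by positivity)]
  gcongr

end Main

end WreathDeformation

/-! ### The numerical constants -/

theorem theorem6 {A B I G N : Type*} [Group A] [Group B] [Group G] [MulAction B I]
    [CStarAlgebra N] [PartialOrder N] [StarOrderedRing N] [WStarAlgebra N]
    (τ : N →ₚ[ℂ] ℂ) (hτ : IsFaithfulNormalTracialState τ)
    (W : WreathLikeProduct A B I G) (ς : W.BoundedSection)
    (ξ : L2 (FinSupp I A) τ.GNS) (t : ℝ) (ht0 : 0 ≤ t) (ht1 : t < 1 / Real.pi) :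
    ‖perpProj (inclGaussian τ.GNS W)
        (gaussianDeformation ς.supportArray
          (Real.sqrt ((Real.pi ^ 2 + 5) / (3 * (Real.pi ^ 2 - 1))) * Real.pi * t)
          (inclGaussian τ.GNS W ξ))‖ ≥
      ‖perpProj (inclIoana I A τ.GNS) (ioanaDeformation t (inclIoana I A τ.GNS ξ))‖ ∧
    ‖perpProj (inclIoana I A τ.GNS) (ioanaDeformation t (inclIoana I A τ.GNS ξ))‖ ≥
      ‖perpProj (inclGaussian τ.GNS W)
        (gaussianDeformation ς.supportArray (Real.sqrt (1 / 3) * Real.pi * t)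
          (inclGaussian τ.GNS W ξ))‖ ∧
    ‖perpProj (inclIoana I A τ.GNS) (ioanaDeformation t (inclIoana I A τ.GNS ξ))‖ ≥
      ‖perpProj (inclGaussian τ.GNS W)
        (gaussianDeformation ς.supportArray (Real.sqrt (1 / 6) * Real.pi * t)
          (inclGaussian τ.GNS W ξ))‖ := by
  have hx0 : 0 ≤ Real.pi * t := by positivity
  -- The range t < 1/π is what places x = πt in [0, 1], where the bounds on sinc apply.
  have hx1 : Real.pi * t ≤ 1 := by
    rw [lt_div_iff₀ Real.pi_pos] at ht1
    linarith
  have hsq : ∀ c : ℝ, 0 ≤ c → (Real.sqrt c * Real.pi * t) ^ 2 = c * (Real.pi * t) ^ 2 := by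
    intro c hc
    rw [mul_assoc, mul_pow, Real.sq_sqrt hc]
  have hexp : ∀ c : ℝ, Real.exp (-c) ^ 2 = Real.exp (-(2 * c)) := by
    intro c
    rw [← Real.exp_nat_mul]
    congr 1
    push_cast
    ring
  have hupper : Real.sinc (Real.pi * t) ^ 2 ≤ Real.exp (-(2 * ((Real.pi * t) ^ 2 / 6))) := by
    rw [← hexp]
    exact pow_le_pow_left₀ ((Real.exp_pos _).le.trans (exp_le_sinc hx0 hx1)) (sinc_le_exp hx0 hx1) 2
  have hlower : Real.exp (-(2 * ((Real.pi * t) ^ 2 / 4))) ≤ Real.sinc (Real.pi * t) ^ 2 := by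
    rw [← hexp]
    exact pow_le_pow_left₀ (Real.exp_pos _).le (exp_le_sinc hx0 hx1) 2
  have hpi : 0 < Real.pi ^ 2 - 1 := by nlinarith [Real.pi_gt_three]
  -- Clearing denominators, (π² + 5)/(3(π² - 1)) ≥ 1/2 says exactly π² ≤ 13. The value 1/2 is what
  -- the squared lower bound exp(-x²/2) ≤ sinc² x requires.
  have hpi' : Real.pi ^ 2 ≤ 13 := by nlinarith [Real.pi_lt_d2, Real.pi_pos]
  refine ⟨norm_perpProj_ioana_le ς ξ t _ (le_trans (Real.exp_le_exp.2 ?_) hlower),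
    norm_perpProj_gaussian_le ς ξ t _ (hupper.trans (Real.exp_le_exp.2 ?_)),
    norm_perpProj_gaussian_le ς ξ t _ (hupper.trans (Real.exp_le_exp.2 ?_))⟩
  · rw [hsq _ (by positivity)]
    have hc : 1 / 2 ≤ (Real.pi ^ 2 + 5) / (3 * (Real.pi ^ 2 - 1)) := by
      rw [div_le_div_iff₀ (by norm_num) (by positivity)]
      linarith
    nlinarith [mul_le_mul_of_nonneg_right hc (sq_nonneg (Real.pi * t))]
  -- For the constant 1/3 the exponents coincide, since the squared upper bound is exp(-x²/3). The
  -- constant 1/6 in the last case is weaker.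
  · rw [hsq _ (by norm_num)]
    linarith
  · rw [hsq _ (by norm_num)]
    nlinarith [sq_nonneg (Real.pi * t)]
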